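/- For integers $n \ge k \ge \ell \ge 0$ and $\varepsilon > 0$ say that there is an $(n,k,\ell,\varepsilon)$-Euclidean dimension reduction if for any points $x_1,\dots,x_n \in \mathbb{R}^k$ of Euclidean norm at most $1$ there exist points $y_1,\dots,y_n \in \mathbb{R}^\ell$ such that $$|x_i-x_j|^2-\varepsilon \le |y_i-y_j|^2 \le |x_i-x_j|^2+\varepsilon \qquad (i,j=1,\dots,n). \tag{1}$$ There exist absolute constants $0<c<1$ and $c_1,c_2>0$ such that for all integers $n,k,\ell\ge 0$ with $n \ge k > ck \ge \ell$ and every real $\varepsilon$ with $1/n^{0.49} \le \varepsilon \le 0.1$, the following hold ($\log$ is the natural logarithm): - if there is an $(n,k,\ell,\varepsilon)$-Euclidean dimension reduction, then $\ell \ge c_1 \log n/\varepsilon^2$; - if $\ell \ge c_2 \log n/\varepsilon^2$, then there is an $(n,k,\ell,\varepsilon)$-Euclidean dimension reduction. That is, such a reduction exists if and only if $\ell = \Omega(\log n/\varepsilon^2)$. Moreover, with the same constants, both assertions hold if condition (1) in the definition is replaced by the multiplicative condition $$(1-\varepsilon)\,|x_i-x_j|^2 \le |y_i-y_j|^2 \le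 (1+\varepsilon)\,|x_i-x_j|^2 \qquad (i,j=1,\dots,n).$$ -/

import Mathlib

/-- There is an `(n, k, ℓ, ε)`-Euclidean dimension reduction (additive distortion): any `n` points
of norm at most one in `ℝ^k` can be replaced by `n` points in `ℝ^ℓ` so that every squared distance
is preserved up to an additive error of at most `ε`. -/
def EuclideanDimReduction (n k l : ℕ) (ε : ℝ) : Prop :=
  ∀ x : Fin n → EuclideanSpace ℝ (Fin k), (∀ i, ‖x i‖ ≤ 1) →
    ∃ y : Fin n → EuclideanSpace ℝ (Fin l), ∀ i j,
      ‖x i - x j‖ ^ 2 - ε ≤ ‖y i - y j‖ ^ 2 ∧ ‖y i - y j‖ ^ 2 ≤ ‖x i - x j‖ ^ 2 + ε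

/-- The multiplicative version: every squared distance is preserved up to a factor in
`[1 - ε, 1 + ε]`. -/
def EuclideanDimReductionMul (n k l : ℕ) (ε : ℝ) : Prop :=
  ∀ x : Fin n → EuclideanSpace ℝ (Fin k), (∀ i, ‖x i‖ ≤ 1) →
    ∃ y : Fin n → EuclideanSpace ℝ (Fin l), ∀ i j,
      (1 - ε) * ‖x i - x j‖ ^ 2 ≤ ‖y i - y j‖ ^ 2 ∧
        ‖y i - y j‖ ^ 2 ≤ (1 + ε) * ‖x i - x j‖ ^ 2

/-! Upper bound: for a unit vector `u` and `l` independent standard Gaussian vectors, the sum of the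
squared inner products with `u` concentrates around `l`. A union bound over the directions `x i - x
j` yields the multiplicative reduction; the additive one follows at distortion `ε / 4`, since
squared distances in the unit ball are at most 4.

Lower bound: an encoding argument. In `t` orthogonal blocks of dimension `b`, place `2 ^ b`
separated points per block (the `v`), and let the `w` be all normalised concatenations of such
points, `2 ^ (t * b)` in number. Inner products with the `v` tell the `w` apart at scale `1 / √t`.
Reduce all `v` together with `M` of the `w`. Rounding the images of the `v` to an `ε`-net costs few
bits when `M` is large; afterwards the table of inner products lies in a space of dimension at most
`l * M`, where volume allows only exponentially many separated tables
(`ApproxDimReduction.card_pow_le`). Comparing counts gives `t * b ≤ 7 * l`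
(`ApproxDimReduction.mul_le`), and `t ~ 1 / ε ^ 2`, `b ~ log n` is the claim. Should `k` be too
small for these blocks, the same bound with fewer or smaller blocks contradicts `100 * l ≤ k`. Large
`ε` and small `n` are handled by packing (`ApproxDimReduction.two_pow_le`). -/

open MeasureTheory Module ProbabilityTheory Filter

/-! ### Volume bounds for separated sets and nets -/

section Packing

variable {E : Type*} [NormedAddCommGroup E] [NormedSpace ℝ E] [FiniteDimensional ℝ E]

/-- Volume bound on the cardinality of an `r`-separated family in a ball of radius `R`. -/
theorem card_le_of_separated_of_norm_le {ι : Type*} (T : Finset ι) (f : ι → E) {r R : ℝ}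
    (hr : 0 < r) (hR : 0 ≤ R) (hf : ∀ i ∈ T, ‖f i‖ ≤ R)
    (h : ∀ i ∈ T, ∀ j ∈ T, i ≠ j → r ≤ ‖f i - f j‖) :
    (T.card : ℝ) ≤ (1 + 2 * R / r) ^ finrank ℝ E := by
  borelize E
  let μ : Measure E := Measure.addHaar
  have hr2 : 0 < r / 2 := by positivity
  have hρ : 0 < R + r / 2 := by positivity
  have D : Set.Pairwise (T : Set ι) (Function.onFun Disjoint fun i => Metric.ball (f i) (r / 2)) := by
    intro i hi j hj hij
    apply Metric.ball_disjoint_ball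
    rw [dist_eq_norm]
    linarith [h i hi j hj hij]
  have A_subset : (⋃ i ∈ T, Metric.ball (f i) (r / 2)) ⊆ Metric.ball (0 : E) (R + r / 2) := by
    refine Set.iUnion₂_subset fun i hi => Metric.ball_subset_ball' ?_
    rw [dist_zero_right]
    linarith [hf i hi]
  have I : (T.card : ENNReal) * ENNReal.ofReal ((r / 2) ^ finrank ℝ E) * μ (Metric.ball 0 1) ≤
      ENNReal.ofReal ((R + r / 2) ^ finrank ℝ E) * μ (Metric.ball 0 1) := by
    rw [← μ.addHaar_ball_of_pos 0 hρ]
    refine le_trans (le_of_eq ?_) (measure_mono A_subset)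
    rw [measure_biUnion_finset D fun c _ => measurableSet_ball]
    simp only [μ.addHaar_ball_of_pos _ hr2, Finset.sum_const, nsmul_eq_mul, mul_assoc]
  have J := (ENNReal.mul_le_mul_iff_left (Metric.measure_ball_pos μ 0 zero_lt_one).ne'
    measure_ball_lt_top.ne).1 I
  have K := ENNReal.toReal_le_of_le_ofReal (pow_nonneg hρ.le _) J
  rw [ENNReal.toReal_mul, ENNReal.toReal_natCast, ENNReal.toReal_ofReal (by positivity)] at K
  have hd : 1 + 2 * R / r = (R + r / 2) / (r / 2) := by field_simp; ring
  rw [hd, div_pow, le_div_iff₀ (by positivity)]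
  exact K

/-- A ball in a finite dimensional space has a finite `r`-net which is also `r`-separated. -/
theorem exists_separated_net (E : Type*) [NormedAddCommGroup E] [NormedSpace ℝ E]
    [FiniteDimensional ℝ E] {r R : ℝ} (hr : 0 < r) (hR : 0 ≤ R) :
    ∃ s : Finset E, (∀ c ∈ s, ‖c‖ ≤ R) ∧ (∀ c ∈ s, ∀ d ∈ s, c ≠ d → r ≤ ‖c - d‖) ∧
      ∀ x : E, ‖x‖ ≤ R → ∃ c ∈ s, ‖x - c‖ < r := by
  classical
  -- Volume bounds the sizes of separated sets, so one of largest size exists; a point far from it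
  -- could be added.
  let S : Set ℕ := {m | ∃ s : Finset E, s.card = m ∧ (∀ c ∈ s, ‖c‖ ≤ R) ∧
    (∀ c ∈ s, ∀ d ∈ s, c ≠ d → r ≤ ‖c - d‖)}
  have hne : S.Nonempty := ⟨0, ∅, by simp⟩
  have hbdd : BddAbove S := by
    refine ⟨⌊(1 + 2 * R / r) ^ finrank ℝ E⌋₊, ?_⟩
    rintro _ ⟨s, rfl, h1, h2⟩
    exact Nat.le_floor (card_le_of_separated_of_norm_le s id hr hR h1 h2)
  obtain ⟨s, hs, h1, h2⟩ := Nat.sSup_mem hne hbdd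
  refine ⟨s, h1, h2, fun x hx => ?_⟩
  by_contra! hcon
  have hxs : x ∉ s := fun hxs => by simpa using (hcon x hxs).trans_lt' hr
  have : s.card + 1 ≤ sSup S := by
    refine le_csSup hbdd ⟨insert x s, Finset.card_insert_of_notMem hxs, ?_, ?_⟩
    · intro c hc
      rcases Finset.mem_insert.1 hc with rfl | hc
      exacts [hx, h1 c hc]
    · intro c hc d hd hcd
      rcases Finset.mem_insert.1 hc with hcx | hcs <;> rcases Finset.mem_insert.1 hd with hdx | hds
      · exact absurd (hcx.trans hdx.symm) hcd
      · rw [hcx]; exact hcon d hds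
      · rw [hdx, norm_sub_rev]; exact hcon c hcs
      · exact h2 c hcs d hds hcd
  omega

/-- Volume lower bound for the cardinality of a net of a ball. -/
theorem le_card_of_net (s : Finset E) {r R : ℝ} (hr : 0 < r) (hR : 0 < R)
    (h : ∀ x : E, ‖x‖ ≤ R → ∃ c ∈ s, ‖x - c‖ < r) :
    (R / r) ^ finrank ℝ E ≤ (s.card : ℝ) := by
  borelize E
  let μ : Measure E := Measure.addHaar
  have hsub : Metric.ball (0 : E) R ⊆ ⋃ c ∈ s, Metric.ball c r := by
    intro x hx
    rw [mem_ball_zero_iff] at hx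
    obtain ⟨c, hc, hxc⟩ := h x hx.le
    exact Set.mem_iUnion₂.2 ⟨c, hc, by rwa [Metric.mem_ball, dist_eq_norm]⟩
  have I : ENNReal.ofReal (R ^ finrank ℝ E) * μ (Metric.ball 0 1) ≤
      (s.card : ENNReal) * ENNReal.ofReal (r ^ finrank ℝ E) * μ (Metric.ball 0 1) := by
    rw [← μ.addHaar_ball_of_pos 0 hR]
    refine (measure_mono hsub).trans ((measure_biUnion_finset_le _ _).trans (le_of_eq ?_))
    simp only [μ.addHaar_ball_of_pos _ hr, Finset.sum_const, nsmul_eq_mul, mul_assoc]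
  have J := (ENNReal.mul_le_mul_iff_left (Metric.measure_ball_pos μ 0 zero_lt_one).ne'
    measure_ball_lt_top.ne).1 I
  have K := ENNReal.toReal_mono (by finiteness) J
  rw [ENNReal.toReal_mul, ENNReal.toReal_natCast, ENNReal.toReal_ofReal (by positivity),
    ENNReal.toReal_ofReal (by positivity)] at K
  rw [div_pow, div_le_iff₀ (by positivity)]
  exact K

/-- The unit ball of `ℝ^b` contains `2 ^ b` points at pairwise distance at least `1 / 2`. -/
theorem exists_half_separated (b : ℕ) :
    ∃ c : Fin (2 ^ b) → EuclideanSpace ℝ (Fin b), (∀ i, ‖c i‖ ≤ 1) ∧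
      ∀ i j, i ≠ j → 1 / 2 ≤ ‖c i - c j‖ := by
  obtain ⟨s, h1, h2, h3⟩ := exists_separated_net (EuclideanSpace ℝ (Fin b))
    (r := 1 / 2) (R := 1) (by norm_num) zero_le_one
  have hcard := le_card_of_net s (by norm_num) zero_lt_one h3
  norm_num at hcard
  have hcard' : Fintype.card (Fin (2 ^ b)) ≤ Fintype.card s := by
    simpa using (by exact_mod_cast hcard : 2 ^ b ≤ s.card)
  obtain ⟨e⟩ := Function.Embedding.nonempty_of_card_le hcard'
  exact ⟨fun i => e i, fun i => h1 _ (e i).2, fun i j hij => h2 _ (e i).2 _ (e j).2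
    fun hc => hij (e.injective (Subtype.ext hc))⟩

end Packing

/-! ### Concentration of Gaussian projections -/

section Gaussian

/-- Exponential moments of the square of a standard Gaussian. -/
theorem integral_exp_mul_sq_gaussianReal {s : ℝ} (hs : s < 1 / 2) :
    Integrable (fun x => Real.exp (s * (x ^ 2 - 1))) (gaussianReal 0 1) ∧
      ∫ x, Real.exp (s * (x ^ 2 - 1)) ∂(gaussianReal 0 1) =
        Real.exp (-s) * √(1 / (1 - 2 * s)) := by
  have hb : 0 < 1 / 2 - s := by linarith
  have hpt : ∀ x : ℝ, gaussianPDFReal 0 1 x * Real.exp (s * (x ^ 2 - 1)) =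
      (√(2 * Real.pi))⁻¹ * Real.exp (-s) * Real.exp (-(1 / 2 - s) * x ^ 2) := by
    intro x
    simp only [gaussianPDFReal, NNReal.coe_one, mul_one, sub_zero]
    rw [mul_assoc, mul_assoc, ← Real.exp_add, ← Real.exp_add]
    congr 2
    ring
  constructor
  · rw [gaussianReal_of_var_ne_zero _ one_ne_zero,
      integrable_withDensity_iff_integrable_smul₀' (by fun_prop)
        (Filter.Eventually.of_forall fun _ => gaussianPDF_lt_top)]
    simp only [toReal_gaussianPDF, smul_eq_mul, hpt]
    exact (integrable_exp_neg_mul_sq hb).const_mul _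
  · rw [integral_gaussianReal_eq_integral_smul one_ne_zero]
    simp only [smul_eq_mul, hpt]
    rw [integral_const_mul, integral_gaussian]
    have h1 : Real.pi / (1 / 2 - s) = (2 * Real.pi) * (1 / (1 - 2 * s)) := by
      have : 1 - 2 * s ≠ 0 := by linarith
      have : 1 / 2 - s ≠ 0 := hb.ne'
      field_simp
    rw [h1, Real.sqrt_mul (by positivity : 0 ≤ 2 * Real.pi)]
    have : √(2 * Real.pi) ≠ 0 := by positivity
    generalize √(1 / (1 - 2 * s)) = q, √(2 * Real.pi) = p at *
    field_simp

/-- The linear terms of `-s - log (1 - 2 * s) / 2` cancel; the Taylor remainder of the logarithm is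
at most `8 * s ^ 2`, and half of it remains. -/
theorem exp_neg_mul_sqrt_le {s : ℝ} (hs : |s| ≤ 1 / 4) :
    Real.exp (-s) * √(1 / (1 - 2 * s)) ≤ Real.exp (4 * s ^ 2) := by
  have hs' := abs_le.1 hs
  have hpos : 0 < 1 - 2 * s := by linarith
  have habs : |2 * s| ≤ 1 / 2 := by rw [abs_mul, abs_two]; linarith
  have hlog := Real.abs_log_sub_add_sum_range_le (x := 2 * s) (by linarith) 1
  have hle : |2 * s| ^ 2 / (1 - |2 * s|) ≤ 8 * s ^ 2 := by
    rw [div_le_iff₀ (by linarith), sq_abs]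
    nlinarith [sq_nonneg s]
  norm_num at hlog hle
  have h2 := (abs_le.1 (hlog.trans hle)).1
  rw [← Real.exp_log (show 0 < √(1 / (1 - 2 * s)) by positivity), ← Real.exp_add,
    Real.exp_le_exp, Real.log_sqrt (by positivity), one_div, Real.log_inv]
  linarith

variable {E : Type*} [NormedAddCommGroup E] [InnerProductSpace ℝ E] [FiniteDimensional ℝ E]
  [MeasurableSpace E] [BorelSpace E]

theorem stdGaussian_map_inner (u : E) (hu : ‖u‖ = 1) :
    (stdGaussian E).map (fun g => inner ℝ u g) = gaussianReal 0 1 := by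
  have := IsGaussian.map_eq_gaussianReal (μ := stdGaussian E) (InnerProductSpace.toDual ℝ E u)
  rw [variance_dual_stdGaussian, integral_strongDual_stdGaussian] at this
  have hcoe : ⇑(InnerProductSpace.toDual ℝ E u) = fun g => inner ℝ u g := by
    ext g; simp
  rw [hcoe] at this
  simpa [hu] using this

/-- Exponential moments of the squared norm of a Gaussian projection of a unit vector. -/
theorem integral_exp_sum_inner_sq_le (l : ℕ) (u : E) (hu : ‖u‖ = 1) {s : ℝ} (hs : |s| ≤ 1 / 4) :
    Integrable (fun g : Fin l → E => Real.exp (s * ((∑ j, inner ℝ u (g j) ^ 2) - l)))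
        (Measure.pi fun _ => stdGaussian E) ∧
      ∫ g : Fin l → E, Real.exp (s * ((∑ j, inner ℝ u (g j) ^ 2) - l))
        ∂(Measure.pi fun _ => stdGaussian E) ≤ Real.exp (4 * s ^ 2 * l) := by
  have hs2 : s < 1 / 2 := by linarith [(abs_le.1 hs).2]
  have hprod : (fun g : Fin l → E => Real.exp (s * ((∑ j, inner ℝ u (g j) ^ 2) - l))) =
      fun g => ∏ j, Real.exp (s * (inner ℝ u (g j) ^ 2 - 1)) := by
    funext g
    rw [← Real.exp_sum, ← Finset.mul_sum, Finset.sum_sub_distrib]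
    simp
  obtain ⟨hint, hval⟩ := integral_exp_mul_sq_gaussianReal hs2
  rw [← stdGaussian_map_inner u hu] at hint hval
  have hm : AEMeasurable (fun g : E => inner ℝ u g) (stdGaussian E) := by fun_prop
  rw [integral_map hm (by fun_prop)] at hval
  have hint' := hint.comp_aemeasurable hm
  rw [hprod]
  constructor
  · exact Integrable.fintype_prod fun _ => hint'
  · rw [integral_fintype_prod_eq_pow (fun g : E => Real.exp (s * (inner ℝ u g ^ 2 - 1))), hval,
      Fintype.card_fin, mul_comm (4 * s ^ 2) (l : ℝ), Real.exp_nat_mul]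
    exact pow_le_pow_left₀ (by positivity) (exp_neg_mul_sqrt_le hs) _

/-- Johnson–Lindenstrauss for a finite family of unit vectors. -/
theorem exists_sum_inner_sq_close {ι : Type*} [Fintype ι] (l : ℕ) (u : ι → E)
    (hu : ∀ i, ‖u i‖ = 1) {ε : ℝ} (hε : 0 < ε) (hε1 : ε ≤ 1)
    (h : 2 * (Fintype.card ι : ℝ) * Real.exp (-(ε ^ 2 * l / 16)) < 1) :
    ∃ g : Fin l → E, ∀ i, |(∑ j, inner ℝ (u i) (g j) ^ 2) - l| ≤ ε * l := by
  set μ : Measure (Fin l → E) := Measure.pi fun _ => stdGaussian E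
  let S : ι → (Fin l → E) → ℝ := fun i g => (∑ j, inner ℝ (u i) (g j) ^ 2) - l
  -- `G i g < 1` makes both exponents negative, which is the two-sided bound on `S i g`. The
  -- parameter `ε / 8` gives mean exponent `-ε²l/8 + 4(ε/8)²l = -ε²l/16`.
  let G : ι → (Fin l → E) → ℝ := fun i g =>
    Real.exp (-(ε ^ 2 * l / 8)) * (Real.exp (ε / 8 * S i g) + Real.exp (-(ε / 8) * S i g))
  have hp := fun i => integral_exp_sum_inner_sq_le l (u i) (hu i) (s := ε / 8)
    (by rw [abs_le]; constructor <;> linarith)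
  have hn := fun i => integral_exp_sum_inner_sq_le l (u i) (hu i) (s := -(ε / 8))
    (by rw [abs_le]; constructor <;> linarith)
  have hGint : ∀ i, Integrable (G i) μ := fun i => ((hp i).1.add (hn i).1).const_mul _
  have hGle : ∀ i, ∫ g, G i g ∂μ ≤ 2 * Real.exp (-(ε ^ 2 * l / 16)) := by
    intro i
    simp only [G]
    rw [integral_const_mul, integral_add (hp i).1 (hn i).1]
    have e1 : Real.exp (-(ε ^ 2 * l / 16)) =
        Real.exp (-(ε ^ 2 * l / 8)) * Real.exp (4 * (ε / 8) ^ 2 * l) := by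
      rw [← Real.exp_add]; congr 1; ring
    have h2 := (hn i).2
    rw [neg_sq] at h2
    rw [e1]
    nlinarith [(hp i).2, h2, Real.exp_pos (-(ε ^ 2 * l / 8))]
  have hFint : Integrable (fun g => ∑ i, G i g) μ := integrable_finsetSum _ fun i _ => hGint i
  obtain ⟨g, hg⟩ := exists_le_integral hFint
  have hlt : ∑ i, G i g < 1 := by
    refine hg.trans_lt (lt_of_le_of_lt ?_ h)
    rw [integral_finsetSum _ fun i _ => hGint i]
    refine (Finset.sum_le_sum fun i _ => hGle i).trans (le_of_eq ?_)
    rw [Finset.sum_const, nsmul_eq_mul, Finset.card_univ]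
    ring
  refine ⟨g, fun i => ?_⟩
  have hi : G i g < 1 := (Finset.single_le_sum (f := fun i => G i g)
    (fun i _ => by positivity) (Finset.mem_univ i)).trans_lt hlt
  simp only [G, mul_add, ← Real.exp_add] at hi
  have h1 : Real.exp (-(ε ^ 2 * l / 8) + ε / 8 * S i g) < 1 := by
    linarith [Real.exp_pos (-(ε ^ 2 * l / 8) + -(ε / 8) * S i g)]
  have h2 : Real.exp (-(ε ^ 2 * l / 8) + -(ε / 8) * S i g) < 1 := by
    linarith [Real.exp_pos (-(ε ^ 2 * l / 8) + ε / 8 * S i g)]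
  rw [Real.exp_lt_one_iff] at h1 h2
  rw [abs_le]
  constructor
  · by_contra! hc
    nlinarith [mul_lt_mul_of_pos_left hc hε]
  · by_contra! hc
    nlinarith [mul_lt_mul_of_pos_left hc hε]

end Gaussian

/-! ### Upper bound on the target dimension -/

/-- The Johnson–Lindenstrauss lemma. -/
theorem euclideanDimReductionMul_of_log_le {n k l : ℕ} {ε : ℝ} (hn : 2 ≤ n) (hε : 0 < ε)
    (hε1 : ε ≤ 1) (hl : 64 * (Real.log n / ε ^ 2) ≤ (l : ℝ)) :
    EuclideanDimReductionMul n k l ε := by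
  intro x _
  have hn' : (2 : ℝ) ≤ n := by exact_mod_cast hn
  have hlog : 0 < Real.log n := Real.log_pos (by linarith)
  have hlpos : (0 : ℝ) < l := lt_of_lt_of_le (by positivity) hl
  -- The constant `64 = 4 * 16` yields a factor `n ^ (-4)` against at most `n ^ 2` pairs.
  have hexp : 4 * Real.log n ≤ ε ^ 2 * l / 16 := by
    rw [← mul_div_assoc, div_le_iff₀ (by positivity)] at hl
    linarith
  let ι := {p : Fin n × Fin n // x p.1 - x p.2 ≠ 0}
  have hcard : (Fintype.card ι : ℝ) ≤ (n : ℝ) ^ 2 := by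
    have := Fintype.card_subtype_le fun p : Fin n × Fin n => x p.1 - x p.2 ≠ 0
    rw [Fintype.card_prod, Fintype.card_fin] at this
    calc (Fintype.card ι : ℝ) ≤ ((n * n : ℕ) : ℝ) := by exact_mod_cast this
      _ = (n : ℝ) ^ 2 := by push_cast; ring
  have hsmall : 2 * (Fintype.card ι : ℝ) * Real.exp (-(ε ^ 2 * l / 16)) < 1 := by
    have h1 : Real.exp (-(ε ^ 2 * l / 16)) ≤ ((n : ℝ) ^ 4)⁻¹ := by
      rw [Real.exp_neg]
      gcongr
      calc (n : ℝ) ^ 4 = Real.exp (4 * Real.log n) := by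
            rw [show (4 : ℝ) = ((4 : ℕ) : ℝ) by norm_num, Real.exp_nat_mul,
              Real.exp_log (by linarith)]
        _ ≤ _ := Real.exp_le_exp.2 hexp
    calc _ ≤ 2 * (n : ℝ) ^ 2 * ((n : ℝ) ^ 4)⁻¹ := by gcongr
      _ = 2 / (n : ℝ) ^ 2 := by field_simp
      _ < 1 := by rw [div_lt_one (by positivity)]; nlinarith
  obtain ⟨g, hg⟩ := exists_sum_inner_sq_close (ι := ι) l
    (fun p => (‖x p.1.1 - x p.1.2‖⁻¹ : ℝ) • (x p.1.1 - x p.1.2))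
    (fun p => by rw [norm_smul, norm_inv, norm_norm, inv_mul_cancel₀ (norm_ne_zero_iff.2 p.2)])
    hε hε1 hsmall
  refine ⟨fun i => WithLp.toLp 2 fun j => (√l)⁻¹ * inner ℝ (x i) (g j), fun i j => ?_⟩
  by_cases hij : x i - x j = 0
  · simp [sub_eq_zero.1 hij]
  have hnorm : ‖(WithLp.toLp 2 fun m => (√l)⁻¹ * inner ℝ (x i) (g m) : EuclideanSpace ℝ (Fin l)) -
      WithLp.toLp 2 fun m => (√l)⁻¹ * inner ℝ (x j) (g m)‖ ^ 2 =
      (l : ℝ)⁻¹ * ∑ m, inner ℝ (x i - x j) (g m) ^ 2 := by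
    rw [EuclideanSpace.norm_sq_eq, Finset.mul_sum]
    refine Finset.sum_congr rfl fun m _ => ?_
    simp only [PiLp.sub_apply, Real.norm_eq_abs, sq_abs, inner_sub_left]
    rw [← mul_sub, mul_pow, inv_pow, Real.sq_sqrt hlpos.le]
  have hb := hg ⟨(i, j), hij⟩
  simp only [inner_smul_left, mul_pow, ← Finset.mul_sum, conj_trivial] at hb
  set D := ∑ m, inner ℝ (x i - x j) (g m) ^ 2
  have hd : 0 < ‖x i - x j‖ ^ 2 := by
    have := norm_pos_iff.2 hij
    positivity
  rw [inv_pow] at hb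
  obtain ⟨hb1, hb2⟩ := abs_le.1 hb
  rw [hnorm]
  have hb1' : (1 - ε) * l ≤ (‖x i - x j‖ ^ 2)⁻¹ * D := by linarith
  have hb2' : (‖x i - x j‖ ^ 2)⁻¹ * D ≤ (1 + ε) * l := by linarith
  rw [inv_mul_eq_div] at hb1' hb2' ⊢
  rw [le_div_iff₀ hd] at hb1'
  rw [div_le_iff₀ hd] at hb2'
  rw [le_div_iff₀ hlpos, div_le_iff₀ hlpos]
  constructor <;> linarith

/-! ### Comparison of the additive and multiplicative conditions -/

theorem EuclideanDimReductionMul.mono {n k l : ℕ} {ε δ : ℝ} (hεδ : ε ≤ δ)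
    (h : EuclideanDimReductionMul n k l ε) : EuclideanDimReductionMul n k l δ := by
  intro x hx
  obtain ⟨y, hy⟩ := h x hx
  refine ⟨y, fun i j => ⟨le_trans ?_ (hy i j).1, (hy i j).2.trans ?_⟩⟩ <;> gcongr

theorem EuclideanDimReductionMul.euclideanDimReduction {n k l : ℕ} {ε : ℝ} (hε : 0 ≤ ε)
    (h : EuclideanDimReductionMul n k l ε) : EuclideanDimReduction n k l (4 * ε) := by
  intro x hx
  obtain ⟨y, hy⟩ := h x hx
  refine ⟨y, fun i j => ?_⟩
  have h1 : ‖x i - x j‖ ≤ 2 := (norm_sub_le _ _).trans (by linarith [hx i, hx j])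
  have h2 : ‖x i - x j‖ ^ 2 ≤ 4 := by nlinarith [norm_nonneg (x i - x j)]
  have h3 := mul_le_mul_of_nonneg_left h2 hε
  constructor <;> linarith [(hy i j).1, (hy i j).2]

/-- A common weakening of the additive and the multiplicative notion of dimension reduction. -/
def ApproxDimReduction (n k l : ℕ) (ε : ℝ) : Prop :=
  ∀ x : Fin n → EuclideanSpace ℝ (Fin k), (∀ i, ‖x i‖ ≤ 1) →
    ∃ y : Fin n → EuclideanSpace ℝ (Fin l), ∀ i j,
      (1 - ε) * ‖x i - x j‖ ^ 2 - ε ≤ ‖y i - y j‖ ^ 2 ∧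
        ‖y i - y j‖ ^ 2 ≤ (1 + ε) * ‖x i - x j‖ ^ 2 + ε

theorem EuclideanDimReduction.approx {n k l : ℕ} {ε : ℝ} (hε : 0 ≤ ε)
    (h : EuclideanDimReduction n k l ε) : ApproxDimReduction n k l ε := by
  intro x hx
  obtain ⟨y, hy⟩ := h x hx
  refine ⟨y, fun i j => ?_⟩
  have h3 := mul_nonneg hε (sq_nonneg ‖x i - x j‖)
  constructor <;> linarith [(hy i j).1, (hy i j).2]

theorem EuclideanDimReductionMul.approx {n k l : ℕ} {ε : ℝ} (hε : 0 ≤ ε)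
    (h : EuclideanDimReductionMul n k l ε) : ApproxDimReduction n k l ε := by
  intro x hx
  obtain ⟨y, hy⟩ := h x hx
  exact ⟨y, fun i j => ⟨by linarith [(hy i j).1], by linarith [(hy i j).2]⟩⟩

/-! ### Packing and counting bounds forced by a reduction -/

section Transfer

variable {n k l : ℕ} {ε : ℝ} {F : Type*} [NormedAddCommGroup F] [InnerProductSpace ℝ F]
  [FiniteDimensional ℝ F] {ι : Type*} [Fintype ι]

theorem exists_linearIsometry_euclideanSpace (hk : finrank ℝ F ≤ k) :
    Nonempty (F →ₗᵢ[ℝ] EuclideanSpace ℝ (Fin k)) := by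
  let b := stdOrthonormalBasis ℝ F
  let e := EuclideanSpace.basisFun (Fin k) ℝ
  let f : F →ₗ[ℝ] EuclideanSpace ℝ (Fin k) :=
    b.toBasis.constr ℝ fun i => e (Fin.castLE hk i)
  refine ⟨f.isometryOfOrthonormal (v := b.toBasis) ?_ ?_⟩
  · simp [b.orthonormal]
  · have : f ∘ b.toBasis = e ∘ Fin.castLE hk := by
      funext i
      simp only [Function.comp, f, Basis.constr_basis]
    rw [this]
    exact e.orthonormal.comp _ (Fin.castLE_injective hk)

/-- Embedding `F` isometrically and padding with copies of the origin frees later constructions from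
exact sizes and coordinates. -/
theorem ApproxDimReduction.exists_image (h : ApproxDimReduction n k l ε)
    (hn : Fintype.card ι ≤ n) (hk : finrank ℝ F ≤ k) (x : ι → F) (hx : ∀ i, ‖x i‖ ≤ 1) :
    ∃ y : ι → EuclideanSpace ℝ (Fin l), ∀ i j,
      (1 - ε) * ‖x i - x j‖ ^ 2 - ε ≤ ‖y i - y j‖ ^ 2 ∧
        ‖y i - y j‖ ^ 2 ≤ (1 + ε) * ‖x i - x j‖ ^ 2 + ε := by
  classical
  obtain ⟨φ⟩ := exists_linearIsometry_euclideanSpace (F := F) hk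
  obtain ⟨e⟩ : Nonempty (ι ↪ Fin n) :=
    Function.Embedding.nonempty_of_card_le (by simpa using hn)
  obtain ⟨y, hy⟩ := h (Function.extend e (fun i => φ (x i)) 0) fun j => by
    by_cases hj : ∃ i, e i = j
    · obtain ⟨i, rfl⟩ := hj
      rw [e.injective.extend_apply, φ.norm_map]
      exact hx i
    · rw [Function.extend_apply' _ _ _ hj]
      simp
  refine ⟨fun i => y (e i), fun i j => ?_⟩
  have := hy (e i) (e j)
  rwa [e.injective.extend_apply, e.injective.extend_apply, ← map_sub, φ.norm_map] at this

/-- Dimension reduction approximately preserves inner products. -/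
theorem ApproxDimReduction.exists_image_inner (h : ApproxDimReduction n k l ε) (hε : 0 ≤ ε)
    (hn : Fintype.card ι + 1 ≤ n) (hk : finrank ℝ F ≤ k) (x : ι → F) (hx : ∀ i, ‖x i‖ ≤ 1) :
    ∃ z : ι → EuclideanSpace ℝ (Fin l), ∀ i j,
      |inner ℝ (z i) (z j) - inner ℝ (x i) (x j)| ≤ 5 * ε := by
  -- Adjoining the origin turns norms into distances; polarization then gives error at most `(2ε +
  -- 2ε + 5ε) / 2`.
  obtain ⟨y, hy⟩ := h.exists_image (ι := Option ι) (by simpa using hn) hk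
    (fun o => o.elim 0 x) (by rintro (_ | i) <;> simp [hx])
  refine ⟨fun i => y (some i) - y none, fun i j => ?_⟩
  have hi := hy (some i) none
  have hj := hy (some j) none
  have hij := hy (some i) (some j)
  simp only [Option.elim, sub_zero] at hi hj hij
  have e1 := norm_sub_sq_real (y (some i) - y none) (y (some j) - y none)
  rw [sub_sub_sub_cancel_right] at e1
  have e2 := norm_sub_sq_real (x i) (x j)
  have n1 : ‖x i‖ ^ 2 ≤ 1 := by nlinarith [hx i, norm_nonneg (x i)]
  have n2 : ‖x j‖ ^ 2 ≤ 1 := by nlinarith [hx j, norm_nonneg (x j)]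
  have n3 : ‖x i - x j‖ ≤ 2 := (norm_sub_le _ _).trans (by linarith [hx i, hx j])
  have n4 : ‖x i - x j‖ ^ 2 ≤ 4 := by nlinarith [norm_nonneg (x i - x j)]
  have m1 := mul_le_mul_of_nonneg_left n1 hε
  have m2 := mul_le_mul_of_nonneg_left n2 hε
  have m4 := mul_le_mul_of_nonneg_left n4 hε
  rw [abs_le]
  constructor <;> linarith [hi.1, hi.2, hj.1, hj.2, hij.1, hij.2]

/-- Packing bound: a reduction keeps `2 ^ b` separated points separated. -/
theorem ApproxDimReduction.two_pow_le (h : ApproxDimReduction n k l ε)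
    (hε1 : ε ≤ 0.1) {b : ℕ} (hb : 2 ^ b ≤ n) (hbk : b ≤ k) : (2 : ℝ) ^ b ≤ 21 ^ l := by
  obtain ⟨c, hc1, hc2⟩ := exists_half_separated b
  obtain ⟨y, hy⟩ := h.exists_image (by simpa using hb) (by simpa using hbk) c hc1
  let i₀ : Fin (2 ^ b) := ⟨0, by positivity⟩
  have key := card_le_of_separated_of_norm_le Finset.univ (fun i => y i - y i₀) (r := 0.3)
    (R := 3) (by norm_num) (by norm_num) ?_ ?_
  · norm_num at key
    exact key
  · intro i _
    have n3 : ‖c i - c i₀‖ ≤ 2 := (norm_sub_le _ _).trans (by linarith [hc1 i, hc1 i₀])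
    have n4 : ‖c i - c i₀‖ ^ 2 ≤ 4 := by nlinarith [norm_nonneg (c i - c i₀)]
    refine abs_le_of_sq_le_sq' ?_ (by norm_num) |>.2
    nlinarith [(hy i i₀).2, sq_nonneg ‖c i - c i₀‖]
  · intro i _ j _ hij
    rw [sub_sub_sub_cancel_right]
    have h1 := hc2 i j hij
    refine abs_le_of_sq_le_sq' ?_ (norm_nonneg _) |>.2
    nlinarith [(hy i j).1]

/-- Counting bound: if the vectors `w a` can be told apart by their inner products with the
vectors `v i`, a dimension reduction yields an encoding of `M`-tuples of vectors `w a`. -/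
theorem ApproxDimReduction.card_pow_le {V W : Type*} [Fintype V] [Fintype W]
    (h : ApproxDimReduction n k l ε) (hε : 0 < ε) (hε1 : ε ≤ 0.1) {M : ℕ}
    (hn : Fintype.card V + M + 1 ≤ n) (hk : finrank ℝ F ≤ k) (v : V → F) (w : W → F)
    (hv : ∀ i, ‖v i‖ ≤ 1) (hw : ∀ a, ‖w a‖ ≤ 1) {ρ δ r : ℝ} (hρ : 0 ≤ ρ) (hr : 0 < r)
    (hvw : ∀ i a, |inner ℝ (v i) (w a)| ≤ ρ)
    (hsep : ∀ a b, a ≠ b → ∃ i, δ ≤ |inner ℝ (v i) (w a) - inner ℝ (v i) (w b)|)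
    (hδ : r + 14 * ε ≤ δ) :
    (Fintype.card W : ℝ) ^ M ≤
      (1 + 4 / ε) ^ (l * Fintype.card V) * (1 + 2 * (ρ + 7 * ε) / r) ^ (l * M) := by
  classical
  have hz : ∀ T : Fin M → W, ∃ z : V ⊕ Fin M → EuclideanSpace ℝ (Fin l), ∀ i j,
      |inner ℝ (z i) (z j) -
        inner ℝ ((Sum.elim v (fun m => w (T m))) i) ((Sum.elim v (fun m => w (T m))) j)| ≤ 5 * ε :=
    fun T => h.exists_image_inner hε.le (by simpa using hn) hk _
      (by rintro (i | m) <;> simp [hv, hw])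
  choose z hz using hz
  have hznorm : ∀ T i, ‖z T i‖ ≤ 2 := by
    intro T i
    have h1 := (abs_le.1 (hz T i i)).2
    have h2 : ‖(Sum.elim v (fun m => w (T m))) i‖ ≤ 1 := by
      rcases i with i | m <;> simp [hv, hw]
    rw [real_inner_self_eq_norm_sq, real_inner_self_eq_norm_sq] at h1
    refine abs_le_of_sq_le_sq' ?_ (by norm_num) |>.2
    nlinarith [norm_nonneg ((Sum.elim v (fun m => w (T m))) i)]
  -- Only the images of the `v i` are rounded. This adds `2 * ε` to the inner product error, giving
  -- `7 * ε`.
  obtain ⟨s, hs1, hs2, hs3⟩ := exists_separated_net (EuclideanSpace ℝ (Fin l)) hε zero_le_two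
  have hscard := card_le_of_separated_of_norm_le s id hε zero_le_two hs1 hs2
  have hA : ∀ (T : Fin M → W) (i : V), ∃ c : s, ‖z T (.inl i) - c‖ < ε := fun T i => by
    obtain ⟨c, hc, hc'⟩ := hs3 _ (hznorm T (.inl i))
    exact ⟨⟨c, hc⟩, hc'⟩
  choose A hA using hA
  have hclose : ∀ (T : Fin M → W) (i : V) (m : Fin M),
      |inner ℝ (A T i : EuclideanSpace ℝ (Fin l)) (z T (.inr m)) - inner ℝ (v i) (w (T m))|
        ≤ 7 * ε := by
    intro T i m
    have h1 := hz T (.inl i) (.inr m)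
    simp only [Sum.elim_inl, Sum.elim_inr] at h1
    have h2 : |inner ℝ (z T (.inl i)) (z T (.inr m)) -
        inner ℝ (A T i : EuclideanSpace ℝ (Fin l)) (z T (.inr m))| ≤ ε * 2 := by
      rw [← inner_sub_left]
      exact (abs_real_inner_le_norm _ _).trans
        (mul_le_mul (hA T i).le (hznorm T _) (norm_nonneg _) hε.le)
    rw [abs_le] at h1 h2 ⊢
    constructor <;> linarith [h1.1, h1.2, h2.1, h2.2]
  have hB : 0 ≤ 2 * (ρ + 7 * ε) / r := by positivity
  have hfib : ∀ a : V → s, ((Finset.univ.filter fun T : Fin M → W => A T = a).card : ℝ) ≤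
      (1 + 2 * (ρ + 7 * ε) / r) ^ (l * M) := by
    intro a
    -- For fixed rounded images the table of inner products is linear in the images of the `w`, so
    -- its range has dimension at most `l * M` whatever the size of `V`. Packing is applied there in
    -- the sup norm.
    let L : (Fin M → EuclideanSpace ℝ (Fin l)) →ₗ[ℝ] (Fin M → V → ℝ) :=
      LinearMap.pi fun m => LinearMap.pi fun i =>
        (innerₛₗ ℝ (a i : EuclideanSpace ℝ (Fin l))).comp (LinearMap.proj m)
    have hL : ∀ y m i, L y m i = inner ℝ (a i : EuclideanSpace ℝ (Fin l)) (y m) :=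
      fun y m i => rfl
    have hrank : finrank ℝ (LinearMap.range L) ≤ l * M := by
      refine (LinearMap.finrank_range_le L).trans (le_of_eq ?_)
      rw [finrank_pi_fintype]
      simp [mul_comm]
    refine (card_le_of_separated_of_norm_le (E := LinearMap.range L) _
      (fun T => ⟨L fun m => z T (.inr m), LinearMap.mem_range_self L _⟩) hr
      (R := ρ + 7 * ε) (by positivity) ?_ ?_).trans
        (pow_le_pow_right₀ (by linarith) hrank)
    · intro T hT
      obtain rfl := (Finset.mem_filter.1 hT).2
      rw [Submodule.coe_norm, pi_norm_le_iff_of_nonneg (by positivity)]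
      intro m
      rw [pi_norm_le_iff_of_nonneg (by positivity)]
      intro i
      change ‖L (fun m => z T (.inr m)) m i‖ ≤ _
      rw [hL, Real.norm_eq_abs]
      have h1 := hclose T i m
      have h2 := hvw i (T m)
      rw [abs_le] at h1 h2 ⊢
      constructor <;> linarith [h1.1, h1.2, h2.1, h2.2]
    · intro T hT T' hT' hne
      obtain rfl := (Finset.mem_filter.1 hT).2
      have hT' := (Finset.mem_filter.1 hT').2
      obtain ⟨m, hm⟩ := Function.ne_iff.1 hne
      obtain ⟨i, hi⟩ := hsep _ _ hm
      have h1 := hclose T i m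
      have h2 := hclose T' i m
      rw [hT'] at h2
      rw [Submodule.coe_norm, Submodule.coe_sub]
      let f := L (fun m => z T (.inr m)) - L fun m => z T' (.inr m)
      change r ≤ ‖f‖
      refine le_trans ?_ ((norm_le_pi_norm (f m) i).trans (norm_le_pi_norm f m))
      simp only [f]
      rw [Pi.sub_apply, Pi.sub_apply, hL, hL, Real.norm_eq_abs]
      rw [abs_le] at h1 h2
      rcases le_abs.1 hi with hi | hi
      · exact le_abs.2 (Or.inl (by linarith [h1.1, h1.2, h2.1, h2.2]))
      · exact le_abs.2 (Or.inr (by linarith [h1.1, h1.2, h2.1, h2.2]))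
  have htot : (Fintype.card W : ℝ) ^ M =
      ∑ a : V → s, ((Finset.univ.filter fun T : Fin M → W => A T = a).card : ℝ) := by
    have := Finset.card_eq_sum_card_fiberwise (s := (Finset.univ : Finset (Fin M → W)))
      (t := (Finset.univ : Finset (V → s))) (f := A) (fun _ _ => Finset.mem_coe.2 (Finset.mem_univ _))
    rw [Finset.card_univ, Fintype.card_fun, Fintype.card_fin] at this
    exact_mod_cast this
  rw [htot]
  refine (Finset.sum_le_sum fun a _ => hfib a).trans ?_
  rw [Finset.sum_const, nsmul_eq_mul, Finset.card_univ, Fintype.card_fun, Fintype.card_coe]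
  gcongr
  rw [Nat.cast_pow, pow_mul]
  gcongr
  have h22 : (2 : ℝ) * 2 = 4 := by norm_num
  simpa [h22] using hscard

end Transfer

/-! ### The block configuration -/

/-- Block construction: the lower bound on the target dimension, given admissible parameters. -/
theorem ApproxDimReduction.mul_le {n k l : ℕ} {ε : ℝ} (h : ApproxDimReduction n k l ε)
    (hε : 0 < ε) (hε1 : ε ≤ 0.1) {b t M : ℕ} (ht : 0 < t) (hM : 0 < M) (hk : t * b ≤ k)
    (hn : t * 2 ^ b + M + 1 ≤ n) (htε : √t * (224 * ε) ≤ 1)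
    (hcount : (1 + 4 / ε) ^ (t * 2 ^ b) ≤ (2 : ℝ) ^ M) : t * b ≤ 7 * l := by
  classical
  obtain ⟨c, hc1, hc2⟩ := exists_half_separated b
  let F := PiLp 2 fun _ : Fin t => EuclideanSpace ℝ (Fin b)
  let v : Fin t × Fin (2 ^ b) → F := fun p => WithLp.toLp 2 (Pi.single p.1 (c p.2))
  let w : (Fin t → Fin (2 ^ b)) → F := fun τ => WithLp.toLp 2 fun j => (√t)⁻¹ • c (τ j)
  have htpos : (0 : ℝ) < t := by exact_mod_cast ht
  have hst : 0 < √(t : ℝ) := Real.sqrt_pos.2 htpos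
  have hv : ∀ p, ‖v p‖ ≤ 1 := fun p => by
    exact (PiLp.norm_single 2 (fun _ : Fin t => EuclideanSpace ℝ (Fin b)) _ _).trans_le (hc1 _)
  have hw : ∀ τ, ‖w τ‖ ≤ 1 := fun τ => by
    refine abs_le_of_sq_le_sq' ?_ zero_le_one |>.2
    rw [PiLp.norm_sq_eq_of_L2]
    calc ∑ j, ‖w τ j‖ ^ 2 ≤ ∑ j : Fin t, (t : ℝ)⁻¹ := by
          refine Finset.sum_le_sum fun j _ => ?_
          simp only [w, norm_smul, mul_pow]
          rw [norm_inv, Real.norm_of_nonneg hst.le, inv_pow, Real.sq_sqrt htpos.le]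
          have := pow_le_one₀ (n := 2) (norm_nonneg _) (hc1 (τ j))
          exact mul_le_of_le_one_right (by positivity) this
      _ = 1 ^ 2 := by simp [htpos.ne']
  have hinner : ∀ p τ, inner ℝ (v p) (w τ) = (√t)⁻¹ * inner ℝ (c p.2) (c (τ p.1)) := by
    intro p τ
    rw [PiLp.inner_apply, Finset.sum_eq_single p.1]
    · simp [v, w, inner_smul_right]
    · intro j _ hj
      simp [v, hj]
    · simp
  have hvw : ∀ p τ, |inner ℝ (v p) (w τ)| ≤ (√t)⁻¹ := by
    intro p τ
    rw [hinner, abs_mul, abs_of_pos (inv_pos.2 hst)]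
    refine mul_le_of_le_one_right (by positivity) ((abs_real_inner_le_norm _ _).trans ?_)
    exact mul_le_one₀ (hc1 _) (norm_nonneg _) (hc1 _)
  have hsep : ∀ τ τ' : Fin t → Fin (2 ^ b), τ ≠ τ' →
      ∃ p, (√t)⁻¹ / 8 ≤ |inner ℝ (v p) (w τ) - inner ℝ (v p) (w τ')| := by
    intro τ τ' hne
    obtain ⟨j, hj⟩ := Function.ne_iff.1 hne
    have h1 := hc2 _ _ hj
    -- Expanding the left factor, one of the two terms has absolute value at least `1 / 8`; its
    -- point is the test vector.
    have h2 : 1 / 4 ≤ inner ℝ (c (τ j) - c (τ' j)) (c (τ j) - c (τ' j)) := by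
      rw [real_inner_self_eq_norm_sq]
      nlinarith
    rw [inner_sub_left] at h2
    have hpos : 0 < (√(t : ℝ))⁻¹ := by positivity
    by_cases h3 : 1 / 8 ≤ inner ℝ (c (τ j)) (c (τ j) - c (τ' j))
    · refine ⟨(j, τ j), ?_⟩
      rw [hinner, hinner, ← mul_sub, ← inner_sub_right, abs_mul, abs_of_pos hpos, div_eq_mul_one_div]
      exact mul_le_mul_of_nonneg_left (h3.trans (le_abs_self _)) hpos.le
    · refine ⟨(j, τ' j), ?_⟩
      rw [hinner, hinner, ← mul_sub, ← inner_sub_right, abs_mul, abs_of_pos hpos, div_eq_mul_one_div]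
      refine mul_le_mul_of_nonneg_left ?_ hpos.le
      refine le_trans ?_ (neg_le_abs _)
      simp only
      linarith
  -- `224 = 14 * 16`: half of the gap `(√t)⁻¹ / 8` absorbs the error `14 * ε`, the other half is
  -- `r`.
  have hq : 224 * ε ≤ (√(t : ℝ))⁻¹ := by
    rw [← one_div, le_div_iff₀ hst]
    linarith
  have key := h.card_pow_le hε hε1 (M := M) (by simpa using hn) (F := F)
    (by rw [(WithLp.linearEquiv 2 ℝ (Fin t → EuclideanSpace ℝ (Fin b))).finrank_eq,
          finrank_pi_fintype]
        simpa using hk) v w hv hw (ρ := (√t)⁻¹) (δ := (√t)⁻¹ / 8)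
    (r := (√t)⁻¹ / 16) (by positivity) (by positivity) hvw hsep (by linarith)
  have hbase : 1 + 2 * ((√(t : ℝ))⁻¹ + 7 * ε) / ((√(t : ℝ))⁻¹ / 16) ≤ (2 : ℝ) ^ 6 := by
    have : 2 * ((√(t : ℝ))⁻¹ + 7 * ε) / ((√(t : ℝ))⁻¹ / 16) ≤ 63 := by
      rw [div_le_iff₀ (by positivity)]
      linarith
    linarith
  have hbase0 : 0 ≤ 1 + 2 * ((√(t : ℝ))⁻¹ + 7 * ε) / ((√(t : ℝ))⁻¹ / 16) := by positivity
  have hfin : (2 : ℝ) ^ (t * b * M) ≤ 2 ^ (7 * l * M) := by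
    calc (2 : ℝ) ^ (t * b * M) = (Fintype.card (Fin t → Fin (2 ^ b)) : ℝ) ^ M := by
          simp only [Fintype.card_fun, Fintype.card_fin]
          push_cast
          rw [← pow_mul, ← pow_mul]
          congr 1; ring
      _ ≤ _ := key
      _ ≤ ((2 : ℝ) ^ M) ^ l * ((2 : ℝ) ^ 6) ^ (l * M) := by
          refine mul_le_mul ?_ (pow_le_pow_left₀ hbase0 hbase _) (by positivity) (by positivity)
          rw [mul_comm l, pow_mul]
          refine pow_le_pow_left₀ (by positivity) ?_ _
          simpa using hcount
      _ = 2 ^ (7 * l * M) := by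
          rw [← pow_mul, ← pow_mul, ← pow_add]
          congr 1; ring
  have := (pow_le_pow_iff_right₀ (one_lt_two : (1 : ℝ) < 2)).1 hfin
  exact Nat.le_of_mul_le_mul_right this hM

/-! ### Choice of parameters -/

/-- The asymptotic comparisons between the parameters used in the lower bound. -/
theorem exists_large_parameters :
    ∃ n₀ : ℕ, 2 ≤ n₀ ∧ ∀ n : ℕ, n₀ ≤ n → 200 ≤ Real.log n ∧
      (n : ℝ) ^ (0.99 : ℝ) * Real.log (5 * n) ≤ n / 8 ∧ (n : ℝ) ^ (0.99 : ℝ) + 2 ≤ n / 2 := by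
  have h1 : ∀ᶠ x : ℝ in atTop, 200 ≤ Real.log x :=
    Real.tendsto_log_atTop.eventually_ge_atTop 200
  have h2 : ∀ᶠ x : ℝ in atTop, Real.log x ≤ 1 / 32 * x ^ (0.01 : ℝ) := by
    have := Asymptotics.isLittleO_iff.1 (isLittleO_log_rpow_atTop (r := 0.01) (by norm_num))
      (show (0 : ℝ) < 1 / 32 by norm_num)
    filter_upwards [this, eventually_ge_atTop 1] with x hx h1
    rwa [Real.norm_of_nonneg (Real.log_nonneg h1),
      Real.norm_of_nonneg (Real.rpow_nonneg (by linarith) _)] at hx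
  obtain ⟨n₀, hn₀⟩ := eventually_atTop.1
    ((tendsto_natCast_atTop_atTop (R := ℝ)).eventually (h1.and h2))
  refine ⟨max n₀ 5, by simp, fun n hn => ?_⟩
  obtain ⟨h1, h2⟩ := hn₀ n ((le_max_left _ _).trans hn)
  have hn5 : (5 : ℝ) ≤ n := by exact_mod_cast (le_max_right _ _).trans hn
  have hnpos : (0 : ℝ) < n := by linarith
  have hmul : (n : ℝ) ^ (0.99 : ℝ) * (n : ℝ) ^ (0.01 : ℝ) = n := by
    rw [← Real.rpow_add hnpos]; norm_num
  have hpos : 0 < (n : ℝ) ^ (0.99 : ℝ) := Real.rpow_pos_of_pos hnpos _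
  have hlog : Real.log (5 * n) ≤ 2 * Real.log n := by
    rw [Real.log_mul (by norm_num) hnpos.ne']
    linarith [Real.log_le_log (by norm_num) hn5]
  have h3 : (n : ℝ) ^ (0.99 : ℝ) * Real.log n ≤ n / 32 := by
    have := mul_le_mul_of_nonneg_left h2 hpos.le
    linarith
  have h4 := mul_le_mul_of_nonneg_left hlog hpos.le
  have h5 := mul_le_mul_of_nonneg_left h1 hpos.le
  refine ⟨h1, by linarith, ?_⟩
  have h6 : (1 : ℝ) ≤ (n : ℝ) ^ (0.99 : ℝ) := Real.one_le_rpow (by linarith) (by norm_num)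
  linarith

theorem two_pow_floor_le_exp {x : ℝ} (hx : 0 ≤ x) {b : ℕ} (hb : b ≤ ⌊x⌋₊) :
    (2 : ℝ) ^ b ≤ Real.exp x := by
  have h1 : (b : ℝ) ≤ x := (Nat.cast_le.2 hb).trans (Nat.floor_le hx)
  calc (2 : ℝ) ^ b ≤ Real.exp 1 ^ b := by
        gcongr
        linarith [Real.add_one_le_exp 1]
    _ = Real.exp b := by rw [← Real.exp_nat_mul, mul_one]
    _ ≤ Real.exp x := Real.exp_le_exp.2 h1

theorem half_le_floor {x : ℝ} (hx : 1 ≤ x) : x / 2 ≤ (⌊x⌋₊ : ℝ) := by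
  have h1 := Nat.lt_floor_add_one x
  have h2 : (1 : ℝ) ≤ (⌊x⌋₊ : ℝ) := by exact_mod_cast (Nat.one_le_floor_iff x).2 hx
  linarith

/-! ### Lower bound on the target dimension -/

section LowerBound

variable {n k l : ℕ} {ε : ℝ}

theorem inv_sq_le_rpow (hn : 0 < n) (hε : 1 / (n : ℝ) ^ (0.49 : ℝ) ≤ ε) :
    1 / ε ≤ (n : ℝ) ^ (0.49 : ℝ) ∧ 1 / ε ^ 2 ≤ (n : ℝ) ^ (0.98 : ℝ) := by
  have hn' : (0 : ℝ) < n := by exact_mod_cast hn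
  have hpos : 0 < (n : ℝ) ^ (0.49 : ℝ) := Real.rpow_pos_of_pos hn' _
  have hε0 : 0 < ε := lt_of_lt_of_le (by positivity) hε
  have h1 : 1 / ε ≤ (n : ℝ) ^ (0.49 : ℝ) := by
    rw [div_le_iff₀ hε0]
    rwa [div_le_iff₀ hpos, mul_comm] at hε
  refine ⟨h1, ?_⟩
  have h2 := pow_le_pow_left₀ (by positivity) h1 2
  rw [div_pow, one_pow, ← Real.rpow_mul_natCast hn'.le] at h2
  norm_num at h2 ⊢
  exact h2

/-- Here `t ≤ n ^ 0.98` and `2 ^ b ≤ n ^ 0.01`, so the `v` use at most `n ^ 0.99` points. At least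
`n / 2` remain for the `w`, enough to pay for the rounding. -/
theorem ApproxDimReduction.mul_le_of_le_floor (h : ApproxDimReduction n k l ε)
    (hε : 0 < ε) (hεn : 1 / (n : ℝ) ^ (0.49 : ℝ) ≤ ε) (hε1 : ε ≤ 1 / 224) (hn : 2 ≤ n)
    (h2 : (n : ℝ) ^ (0.99 : ℝ) * Real.log (5 * n) ≤ n / 8)
    (h3 : (n : ℝ) ^ (0.99 : ℝ) + 2 ≤ n / 2)
    {b t : ℕ} (ht : 0 < t) (hb : b ≤ ⌊Real.log n / 100⌋₊) (htT : t ≤ ⌊1 / (224 * ε) ^ 2⌋₊)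
    (hk : t * b ≤ k) : t * b ≤ 7 * l := by
  have hn2 : (2 : ℝ) ≤ n := by exact_mod_cast hn
  have hnpos : (0 : ℝ) < n := by linarith
  obtain ⟨hε2, hε3⟩ := inv_sq_le_rpow (by omega) hεn
  have ht1 : (t : ℝ) ≤ 1 / (224 * ε) ^ 2 :=
    (Nat.cast_le.2 htT).trans (Nat.floor_le (by positivity))
  have hb1 : (2 : ℝ) ^ b ≤ (n : ℝ) ^ (0.01 : ℝ) := by
    refine (two_pow_floor_le_exp (div_nonneg (Real.log_nonneg (by linarith)) (by norm_num))
      hb).trans (le_of_eq ?_)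
    rw [Real.rpow_def_of_pos hnpos]
    congr 1; ring
  have ht2 : (t : ℝ) ≤ (n : ℝ) ^ (0.98 : ℝ) := by
    refine ht1.trans (le_trans ?_ hε3)
    gcongr
    linarith
  have hN : ((t * 2 ^ b : ℕ) : ℝ) ≤ (n : ℝ) ^ (0.99 : ℝ) := by
    push_cast
    calc (t : ℝ) * 2 ^ b ≤ (n : ℝ) ^ (0.98 : ℝ) * (n : ℝ) ^ (0.01 : ℝ) := by gcongr
      _ = (n : ℝ) ^ (0.99 : ℝ) := by rw [← Real.rpow_add hnpos]; norm_num
  have hNn : t * 2 ^ b + 2 ≤ n := by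
    have : ((t * 2 ^ b + 2 : ℕ) : ℝ) ≤ n := by push_cast at hN ⊢; linarith
    exact_mod_cast this
  obtain ⟨M, hM⟩ := Nat.exists_eq_add_of_le hNn
  have hMr : (n : ℝ) / 2 ≤ ((M + 1 : ℕ) : ℝ) := by
    have : (n : ℝ) = ((t * 2 ^ b : ℕ) : ℝ) + 2 + M := by exact_mod_cast hM
    push_cast at hN this ⊢
    linarith
  refine h.mul_le hε (by linarith) (M := M + 1) ht (by omega) hk (by omega) ?_ ?_
  · have : √(t : ℝ) ≤ 1 / (224 * ε) := by
      rw [← Real.sqrt_sq (by positivity : (0 : ℝ) ≤ 1 / (224 * ε)), div_pow, one_pow]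
      exact Real.sqrt_le_sqrt ht1
    rwa [le_div_iff₀ (by positivity)] at this
  · have hbase : 1 + 4 / ε ≤ 5 * n := by
      have e1 : 1 ≤ 1 / ε := by rw [le_div_iff₀ hε]; linarith
      have e2 : (n : ℝ) ^ (0.49 : ℝ) ≤ n :=
        Real.rpow_le_self_of_one_le (by linarith) (by norm_num)
      have e3 : 4 / ε = 4 * (1 / ε) := by ring
      rw [e3]
      linarith
    have hlog : Real.log (1 + 4 / ε) ≤ Real.log (5 * n) := Real.log_le_log (by positivity) hbase
    rw [← Real.log_le_log_iff (by positivity) (by positivity), Real.log_pow, Real.log_pow]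
    calc _ ≤ (n : ℝ) ^ (0.99 : ℝ) * Real.log (5 * n) :=
          mul_le_mul hN hlog (Real.log_nonneg (by linarith [div_pos four_pos hε])) (by positivity)
      _ ≤ n / 8 := h2
      _ ≤ n / 2 * Real.log 2 := by nlinarith [Real.log_two_gt_d9]
      _ ≤ _ := by
        have := Real.log_two_gt_d9
        gcongr

theorem ApproxDimReduction.log_div_sq_le_of_small (h : ApproxDimReduction n k l ε)
    (hε : 0 < ε) (hεn : 1 / (n : ℝ) ^ (0.49 : ℝ) ≤ ε) (hε1 : ε ≤ 1 / 224) (hn : 2 ≤ n)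
    (h1 : 200 ≤ Real.log n) (h2 : (n : ℝ) ^ (0.99 : ℝ) * Real.log (5 * n) ≤ n / 8)
    (h3 : (n : ℝ) ^ (0.99 : ℝ) + 2 ≤ n / 2) (hk : 0 < k) (hl : 100 * l ≤ k) :
    Real.log n / ε ^ 2 ≤ 140492800 * l := by
  have key := fun b t => h.mul_le_of_le_floor hε hεn hε1 hn h2 h3 (b := b) (t := t)
  have hT : 1 / (224 * ε) ^ 2 / 2 ≤ (⌊1 / (224 * ε) ^ 2⌋₊ : ℝ) := half_le_floor (by
    rw [le_div_iff₀ (by positivity), one_mul]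
    exact pow_le_one₀ (by positivity) (by linarith))
  have hB : Real.log n / 100 / 2 ≤ (⌊Real.log n / 100⌋₊ : ℝ) := half_le_floor (by linarith)
  set T := ⌊1 / (224 * ε) ^ 2⌋₊
  set B := ⌊Real.log n / 100⌋₊
  have hT0 : 0 < T := by
    have : (0 : ℝ) < T := lt_of_lt_of_le (by positivity) hT
    exact_mod_cast this
  have hB0 : 0 < B := by
    have : (0 : ℝ) < B := by linarith
    exact_mod_cast this
  -- If `T * B` exceeds `k`, either `k` blocks of dimension 1 or `T` blocks of dimension `k / T`
  -- fill more than half of `k`, against `100 * l ≤ k`.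
  have hTB : T * B ≤ 7 * l := by
    by_cases hkT : k ≤ T
    · have := key 1 k hk hB0 hkT (by omega)
      omega
    · have hdiv := Nat.div_add_mod k T
      have hmod := Nat.mod_lt k hT0
      have hq : 1 ≤ k / T := (Nat.one_le_div_iff hT0).2 (by omega)
      rcases le_total B (k / T) with hBk | hBk
      · exact key B T hT0 le_rfl le_rfl ((Nat.mul_le_mul_left T hBk).trans (by omega))
      · have h7 := key (k / T) T hT0 hBk le_rfl (by omega)
        have h8 := Nat.mul_le_mul_left T hq
        omega
  have hTB' : (T : ℝ) * B ≤ 7 * l := by exact_mod_cast hTB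
  have hprod : 1 / (224 * ε) ^ 2 / 2 * (Real.log n / 100 / 2) ≤ (T : ℝ) * B := by gcongr
  have heq : Real.log n / ε ^ 2 =
      20070400 * (1 / (224 * ε) ^ 2 / 2 * (Real.log n / 100 / 2)) := by
    field_simp
    norm_num
  rw [heq]
  linarith

/-- Packing suffices when `ε` is bounded below; `21 ≤ 2 ^ 5` gives the factor 5, and the floor
doubles it. -/
theorem ApproxDimReduction.log_le (h : ApproxDimReduction n k l ε) (hε1 : ε ≤ 0.1)
    (hn : 2 ≤ n) (h1 : 200 ≤ Real.log n) (hk : 0 < k) (hl : 100 * l ≤ k) :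
    Real.log n ≤ 10 * l := by
  have hn2 : (2 : ℝ) ≤ n := by exact_mod_cast hn
  have hle : ∀ b, b ≤ ⌊Real.log n⌋₊ → b ≤ k → b ≤ 5 * l := by
    intro b hb hbk
    have hbn : 2 ^ b ≤ n := by
      have := two_pow_floor_le_exp (by linarith) hb
      rw [Real.exp_log (by linarith)] at this
      exact_mod_cast this
    have h2 := h.two_pow_le hε1 hbn hbk
    have h3 : (2 : ℝ) ^ b ≤ 2 ^ (5 * l) := by
      rw [pow_mul]
      exact h2.trans (pow_le_pow_left₀ (by norm_num) (by norm_num) _)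
    exact (pow_le_pow_iff_right₀ (one_lt_two : (1 : ℝ) < 2)).1 h3
  have hfl : ⌊Real.log n⌋₊ ≤ 5 * l := by
    rcases le_total ⌊Real.log n⌋₊ k with hc | hc
    · exact hle _ le_rfl hc
    · have := hle k hc le_rfl
      omega
  have h4 := half_le_floor (x := Real.log n) (by linarith)
  have h5 : (⌊Real.log n⌋₊ : ℝ) ≤ 5 * l := by exact_mod_cast hfl
  linarith

end LowerBound

/-- The lower bound on the target dimension of an approximate dimension reduction. -/
theorem exists_log_div_sq_le : ∃ K : ℝ, 0 < K ∧ ∀ (n k l : ℕ) (ε : ℝ),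
    2 ≤ n → 0 < k → 100 * l ≤ k → 1 / (n : ℝ) ^ (0.49 : ℝ) ≤ ε → ε ≤ 0.1 →
      ApproxDimReduction n k l ε → Real.log n / ε ^ 2 ≤ K * l := by
  obtain ⟨n₀, hn₀, hpar⟩ := exists_large_parameters
  -- `140492800 = 7 * 400 * 224 ^ 2` serves `n ≥ n₀`; for smaller `n`, `n₀ ^ 2` bounds the left side
  -- and `l ≥ 1`.
  refine ⟨140492800 + (n₀ : ℝ) ^ 2, by positivity, fun n k l ε hn hk hl hεn hε1 h => ?_⟩
  have hn2 : (2 : ℝ) ≤ n := by exact_mod_cast hn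
  have hε : 0 < ε := lt_of_lt_of_le (by positivity) hεn
  have hl0 : (0 : ℝ) ≤ l := l.cast_nonneg
  have hK : (0 : ℝ) ≤ (n₀ : ℝ) ^ 2 * l := by positivity
  by_cases hnn : n₀ ≤ n
  · obtain ⟨h1, h2, h3⟩ := hpar n hnn
    by_cases hε2 : ε ≤ 1 / 224
    · linarith [h.log_div_sq_le_of_small hε hεn hε2 hn h1 h2 h3 hk hl]
    · have h4 := h.log_le hε1 hn h1 hk hl
      have h5 : Real.log n / ε ^ 2 ≤ 10 * l / (1 / 224) ^ 2 := by
        gcongr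
        linarith
      norm_num at h5
      linarith
  · have hl1 : (1 : ℝ) ≤ l := by
      have h2 := h.two_pow_le hε1 (b := 1) (by omega) hk
      have : l ≠ 0 := by
        rintro rfl
        norm_num at h2
      exact_mod_cast Nat.one_le_iff_ne_zero.2 this
    have hnr : (n : ℝ) ≤ n₀ := by exact_mod_cast (not_le.1 hnn).le
    have hlog : Real.log n ≤ n₀ := (Real.log_le_self (by linarith)).trans hnr
    have hinv : 1 / ε ^ 2 ≤ n₀ :=
      ((inv_sq_le_rpow (by omega) hεn).2.trans
        (Real.rpow_le_self_of_one_le (by linarith) (by norm_num))).trans hnr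
    have h6 : Real.log n * (1 / ε ^ 2) ≤ n₀ * n₀ := by gcongr
    rw [div_eq_mul_one_div]
    nlinarith [mul_le_mul_of_nonneg_left hl1 (by positivity : (0 : ℝ) ≤ (n₀ : ℝ) ^ 2)]

theorem corollary2p1 :
    ∃ c : ℝ, 0 < c ∧ c < 1 ∧ ∃ c₁ c₂ : ℝ, 0 < c₁ ∧ 0 < c₂ ∧
      ∀ (n k l : ℕ) (ε : ℝ),
        k ≤ n → c * (k : ℝ) < (k : ℝ) → (l : ℝ) ≤ c * (k : ℝ) →
        1 / (n : ℝ) ^ (0.49 : ℝ) ≤ ε → ε ≤ 0.1 →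
          ((EuclideanDimReduction n k l ε → c₁ * (Real.log n / ε ^ 2) ≤ (l : ℝ)) ∧
            (c₂ * (Real.log n / ε ^ 2) ≤ (l : ℝ) → EuclideanDimReduction n k l ε)) ∧
          ((EuclideanDimReductionMul n k l ε → c₁ * (Real.log n / ε ^ 2) ≤ (l : ℝ)) ∧
            (c₂ * (Real.log n / ε ^ 2) ≤ (l : ℝ) → EuclideanDimReductionMul n k l ε)) := by
  obtain ⟨K, hK, hlow⟩ := exists_log_div_sq_le
  -- `1024 = 64 * 4 ^ 2`, as the upper bound is applied with `ε / 4` to serve both conditions.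
  refine ⟨1 / 100, by norm_num, by norm_num, K⁻¹, 1024, by positivity, by norm_num,
    fun n k l ε hkn hk hl hεn hε1 => ?_⟩
  have hk0 : 0 < k := by
    rcases Nat.eq_zero_or_pos k with rfl | hk0
    · simp at hk
    · exact hk0
  have hn : 2 ≤ n := by
    by_contra hn
    obtain rfl : n = 1 := by omega
    norm_num at hεn
    linarith
  have hl' : 100 * l ≤ k := by
    have : (100 * l : ℝ) ≤ k := by linarith
    exact_mod_cast this
  have hn2 : (2 : ℝ) ≤ n := by exact_mod_cast hn
  have hε : 0 < ε := lt_of_lt_of_le (by positivity) hεn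
  have hlower : ApproxDimReduction n k l ε → K⁻¹ * (Real.log n / ε ^ 2) ≤ (l : ℝ) := fun h =>
    (inv_mul_le_iff₀ hK).2 (hlow n k l ε hn hk0 hl' hεn hε1 h)
  have hupper : 1024 * (Real.log n / ε ^ 2) ≤ (l : ℝ) → EuclideanDimReductionMul n k l (ε / 4) :=
    fun h => euclideanDimReductionMul_of_log_le hn (by positivity) (by linarith)
      (le_trans (le_of_eq (by field_simp; ring)) h)
  refine ⟨⟨fun h => hlower (h.approx hε.le), fun h => ?_⟩,
    ⟨fun h => hlower (h.approx hε.le), fun h => (hupper h).mono (by linarith)⟩⟩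
  have := (hupper h).euclideanDimReduction (by positivity)
  rwa [mul_div_cancel₀ ε (by norm_num : (4 : ℝ) ≠ 0)] at this
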